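/- Let $b>1$ be an integer and let $A\subset\{0,1,\dots,b-1\}$ contain at least one non-zero digit. Put $N=\#A$, $s_0=\log_b N$ and $\gamma_j=\sum_{a\in A}a^j$. A positive integer is admissible if all the digits of its (minimal) radix-$b$ representation belong to $A$. The restricted Dirichlet series $$K(s)=\sum_{\substack{n>0\\ n\ \text{admissible}}} n^{-s}\qquad(\Re s>s_0)$$ converges and has a meromorphic continuation to the whole complex plane, still denoted $K(s)$. For $m\in\mathbb N=\{0,1,2,\dots\}$ and $k\in\mathbb Z$ let $s_{m,k}=s_0-m+\frac{2\pi i k}{\log b}$, and let $\lambda_{m,k}$ be the residue (perhaps vanishing) of $K(s)$ at $s_{m,k}$. Then for all $m\ge1$ and $k\in\mathbb Z$ $$(1-b^{-m})\,\lambda_{m,k}=-\frac1N\sum_{j=1}^m\frac{(m-s_{0,k})(m-1-s_{0,k})\cdots(m-j+1-s_{0,k})}{j!}\,\frac{\gamma_j}{b^j}\,\lambda_{m-j,k}.$$ Moreover, for every $k\in\mathbb Z$, one has $\lambda_{0,k}=0$ if and only if $s_{0,k}$ is not a pole of $K$, and in that case $s_{m,k}$ is not a pole of $K$ for any $m\ge1$.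 -/

import Mathlib

open Filter Topology

noncomputable section

/-- `n` is admissible when every digit of its minimal radix-`b` representation lies in `A`. -/
def Admissible (b : ℕ) (A : Finset ℕ) (n : ℕ) : Prop :=
  ∀ d ∈ Nat.digits b n, d ∈ A

/-- Coefficients of the restricted Dirichlet series `K(s) = ∑'_{n > 0} n ^ (-s)`
(the term of index `0` is ignored by Mathlib's `LSeries`). -/
def admissibleCoeff (b : ℕ) (A : Finset ℕ) : ℕ → ℂ :=
  Set.indicator {n : ℕ | Admissible b A n} (fun _ => 1)

/-- The abscissa of convergence `s₀ = log_b N`, where `N` is the number of admissible digits. -/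
def abscissa (b : ℕ) (A : Finset ℕ) : ℝ :=
  Real.logb b A.card

/-- `K` is a meromorphic continuation to the whole plane of the restricted Dirichlet series:
it is meromorphic on `ℂ`, and it is the sum of the series for `Re s > s₀`. -/
structure IsRestrictedDirichlet (b : ℕ) (A : Finset ℕ) (K : ℂ → ℂ) : Prop where
  meromorphic : MeromorphicOn K Set.univ
  hasSum : ∀ s : ℂ, abscissa b A < s.re → LSeriesHasSum (admissibleCoeff b A) s (K s)

/-- The point `s_{m,k} = s₀ - m + 2πik / log b`. -/
def latticePoint (b : ℕ) (A : Finset ℕ) (m : ℕ) (k : ℤ) : ℂ :=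
  (abscissa b A : ℂ) - m + k * (2 * Real.pi * Complex.I / Real.log b)

/-- The power sums `γ_j = ∑_{a ∈ A} a ^ j` over the admissible digits. -/
def digitPowerSum (A : Finset ℕ) (j : ℕ) : ℂ :=
  ∑ a ∈ A, (a : ℂ) ^ j

/-- The residue of `f` at the isolated singularity `z`: the common value of
`(2πi)⁻¹ ∮ f(w) dw` over all sufficiently small circles centred at `z`. -/
def complexResidue (f : ℂ → ℂ) (z : ℂ) : ℂ :=
  limUnder (𝓝[>] (0 : ℝ)) fun r => (2 * Real.pi * Complex.I)⁻¹ * ∮ w in C(z, r), f w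

/-- `z` is a pole of the meromorphic function `f`. -/
def IsPoleOf (f : ℂ → ℂ) (z : ℂ) : Prop :=
  meromorphicOrderAt f z < 0

end

/-!
Splitting off the last digit, an admissible integer with at least two digits is `b * n + a` with
`n` admissible and `a ∈ A`. Expanding
`(b * n + a) ^ (-s) = (b * n) ^ (-s) * (1 + a / (b * n)) ^ (-s)` in the binomial series and summing
over `n` and `a` gives
`(b ^ s - N) * K(s) = h(s) + ∑_{j ≥ 1} (-s choose j) * γ_j / b ^ j * K(s + j)`
with `h` entire, coming from the one-digit integers. The right-hand side only involves values of
`K` further to the right, so it continues `K` strip by strip. In the strip next to the half-plane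
of convergence `K` can only have simple poles, at the zeros `s_{0,k}` of `b ^ s - N`; poles further
left are only transported by the shifts `s ↦ s + j`, so they stay simple along
`s_{m,k} = s_{0,k} - m`. There `b ^ s - N = -N * (1 - b ^ (-m))`, and comparing residues gives the
recursion.
-/

/-! ### Residues at simple poles -/

theorem eventuallyEq_nhdsNE_of_meromorphicOn {f g : ℂ → ℂ} {U : Set ℂ}
    (hf : MeromorphicOn f U) (hg : MeromorphicOn g U) (hU : IsPreconnected U) {z₀ z : ℂ}
    (hz₀ : z₀ ∈ U) (hz : z ∈ U) (h : f =ᶠ[𝓝[≠] z₀] g) : f =ᶠ[𝓝[≠] z] g := by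
  have top_iff (x : ℂ) : meromorphicOrderAt (f - g) x = ⊤ ↔ f =ᶠ[𝓝[≠] x] g :=
    meromorphicOrderAt_eq_top_iff.trans
      (eventually_congr (.of_forall fun _ => sub_eq_zero))
  rw [← top_iff] at h ⊢
  exact not_imp_not.1 ((hf.sub hg).meromorphicOrderAt_ne_top_of_isPreconnected hU hz hz₀) h

/-- `f` has at most a simple pole at `z`, with residue `c`. The value `c = 0` is allowed and means
that the singularity of `f` at `z` is removable. -/
structure HasSimpleResidue (f : ℂ → ℂ) (z c : ℂ) : Prop where
  meromorphicAt : MeromorphicAt f z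
  tendsto : Tendsto (fun w => (w - z) * f w) (𝓝[≠] z) (𝓝 c)

namespace HasSimpleResidue

variable {f g : ℂ → ℂ} {z c d : ℂ}

theorem congr (hf : HasSimpleResidue f z c) (h : f =ᶠ[𝓝[≠] z] g) : HasSimpleResidue g z c where
  meromorphicAt := hf.meromorphicAt.congr h
  tendsto := hf.tendsto.congr' (h.mono fun w hw => by rw [hw])

theorem of_analyticAt (hf : AnalyticAt ℂ f z) : HasSimpleResidue f z 0 where
  meromorphicAt := hf.meromorphicAt
  tendsto := by
    have h : ContinuousAt (fun w => (w - z) * f w) z := by fun_prop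
    simpa using h.tendsto.mono_left nhdsWithin_le_nhds

theorem add (hf : HasSimpleResidue f z c) (hg : HasSimpleResidue g z d) :
    HasSimpleResidue (fun w => f w + g w) z (c + d) where
  meromorphicAt := hf.meromorphicAt.fun_add hg.meromorphicAt
  tendsto := by simpa only [mul_add] using hf.tendsto.add hg.tendsto

theorem sum {ι : Type*} {s : Finset ι} {f : ι → ℂ → ℂ} {c : ι → ℂ}
    (h : ∀ i ∈ s, HasSimpleResidue (f i) z (c i)) :
    HasSimpleResidue (fun w => ∑ i ∈ s, f i w) z (∑ i ∈ s, c i) where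
  meromorphicAt := .fun_sum fun i hi => (h i hi).meromorphicAt
  tendsto := by
    simpa only [Finset.mul_sum] using tendsto_finsetSum s fun i hi => (h i hi).tendsto

theorem analyticAt_mul (hg : AnalyticAt ℂ g z) (hf : HasSimpleResidue f z c) :
    HasSimpleResidue (fun w => g w * f w) z (g z * c) where
  meromorphicAt := hg.meromorphicAt.fun_mul hf.meromorphicAt
  tendsto := by
    simpa only [mul_left_comm] using
      (hg.continuousAt.tendsto.mono_left nhdsWithin_le_nhds).mul hf.tendsto

theorem comp_add_const (a : ℂ) (hf : HasSimpleResidue f (z + a) c) :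
    HasSimpleResidue (fun w => f (w + a)) z c where
  meromorphicAt := meromorphicAt_comp_add_const_iff_meromorphicAt.2 hf.meromorphicAt
  tendsto := by
    have h : Tendsto (· + a) (𝓝[≠] z) (𝓝[≠] (z + a)) :=
      (continuous_add_const a).continuousWithinAt.tendsto_nhdsWithin fun w hw => by simpa using hw
    simpa only [Function.comp_def, add_sub_add_right_eq_sub] using hf.tendsto.comp h

theorem inv_mul_of_simple_zero (hg : AnalyticAt ℂ g z) (hg₀ : g z = 0) (hg₁ : deriv g z ≠ 0)
    (hf : AnalyticAt ℂ f z) :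
    HasSimpleResidue (fun w => (g w)⁻¹ * f w) z ((deriv g z)⁻¹ * f z) where
  meromorphicAt := hg.meromorphicAt.fun_inv.fun_mul hf.meromorphicAt
  tendsto := by
    have hslope := (hasDerivAt_iff_tendsto_slope.1 hg.differentiableAt.hasDerivAt).inv₀ hg₁
    refine (hslope.mul (hf.continuousAt.tendsto.mono_left nhdsWithin_le_nhds)).congr fun w => ?_
    rw [slope_def_field, hg₀, sub_zero, inv_div, div_eq_mul_inv, mul_assoc]

theorem isPoleOf_iff (hf : HasSimpleResidue f z c) : IsPoleOf f z ↔ c ≠ 0 := by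
  have hsub : MeromorphicAt (fun w => w - z) z := by fun_prop
  have horder : meromorphicOrderAt (fun w => (w - z) * f w) z = 1 + meromorphicOrderAt f z := by
    have hsub₁ : meromorphicOrderAt (fun w => w - z) z = (1 : ℤ) :=
      (meromorphicOrderAt_eq_int_iff hsub).2 ⟨1, analyticAt_const, one_ne_zero, by simp⟩
    rw [fun_meromorphicOrderAt_mul hsub hf.meromorphicAt, hsub₁, WithTop.coe_one]
  have hpos : 0 < 1 + meromorphicOrderAt f z ↔ 0 ≤ meromorphicOrderAt f z := by
    cases meromorphicOrderAt f z with
    | top => simp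
    | coe n => norm_cast; omega
  rw [IsPoleOf, ← not_le, not_iff_not, ← hpos, ← horder,
    ← tendsto_zero_iff_meromorphicOrderAt_pos (hsub.fun_mul hf.meromorphicAt)]
  exact ⟨tendsto_nhds_unique hf.tendsto, fun h => h ▸ hf.tendsto⟩

theorem exists_analyticAt (hf : HasSimpleResidue f z c) :
    ∃ g : ℂ → ℂ, AnalyticAt ℂ g z ∧ g z = c ∧ ∀ᶠ w in 𝓝[≠] z, f w = (w - z)⁻¹ * g w := by
  refine ⟨Function.update (fun w => (w - z) * f w) z c, ?_, Function.update_self .., ?_⟩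
  · refine Complex.analyticAt_of_differentiable_on_punctured_nhds_of_continuousAt ?_
      (continuousAt_update_same.2 hf.tendsto)
    filter_upwards [hf.meromorphicAt.eventually_analyticAt, self_mem_nhdsWithin] with w hw hwz
    have hdiff : DifferentiableAt ℂ (fun w => (w - z) * f w) w :=
      (differentiableAt_id.sub_const z).mul hw.differentiableAt
    exact hdiff.congr_of_eventuallyEq
      ((eventually_ne_nhds hwz).mono fun v hv => Function.update_of_ne hv ..)
  · filter_upwards [self_mem_nhdsWithin] with w hw
    rw [Function.update_of_ne hw, inv_mul_cancel_left₀ (sub_ne_zero.2 hw)]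

theorem complexResidue_eq (hf : HasSimpleResidue f z c) : complexResidue f z = c := by
  obtain ⟨g, hg, rfl, hfg⟩ := hf.exists_analyticAt
  obtain ⟨ε, hε, hball⟩ := Metric.eventually_nhds_iff.1
    ((eventually_nhdsWithin_iff.1 hfg).and hg.eventually_analyticAt)
  refine Tendsto.limUnder_eq (tendsto_const_nhds.congr' ?_)
  filter_upwards [Ioo_mem_nhdsGT hε] with r ⟨hr₀, hrε⟩
  have hg_diff : DifferentiableOn ℂ g (Metric.closedBall z r) := fun w hw =>
    (hball (hw.trans_lt hrε)).2.differentiableAt.differentiableWithinAt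
  have hfg_circle : ∮ w in C(z, r), f w = ∮ w in C(z, r), (w - z)⁻¹ • g w :=
    circleIntegral.integral_congr hr₀.le fun w hw =>
      (hball ((Metric.mem_sphere.1 hw).trans_lt hrε)).1 (Metric.ne_of_mem_sphere hw hr₀.ne')
  rw [hfg_circle, hg_diff.circleIntegral_sub_inv_smul (Metric.mem_ball_self hr₀), smul_eq_mul,
    inv_mul_cancel_left₀ Complex.two_pi_I_ne_zero]

end HasSimpleResidue

/-! ### Continuation by a shift equation -/

/-- The tail `∑_{j ≥ m} c_j(s) L(s + j)` of a series of shifts of `L`, indexed from `0`. -/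
noncomputable def shiftTail (c : ℕ → ℂ → ℂ) (L : ℂ → ℂ) (m : ℕ) (s : ℂ) : ℂ :=
  ∑' j : ℕ, c (j + m) s * L (s + (j + m : ℕ))

theorem shiftTail_one_eq_sum_add {c : ℕ → ℂ → ℂ} {L : ℂ → ℂ} {m : ℕ} {s : ℂ}
    (h : Summable fun j => c (j + (m + 1)) s * L (s + (j + (m + 1) : ℕ))) :
    shiftTail c L 1 s = ∑ j ∈ Finset.Icc 1 m, c j s * L (s + j) + shiftTail c L (m + 1) s := by
  have h₁ : Summable fun j => c (j + 1) s * L (s + (j + 1 : ℕ)) :=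
    (summable_nat_add_iff m).1 (by simpa only [add_assoc] using h)
  rw [shiftTail, ← h₁.sum_add_tsum_nat_add m, Finset.range_eq_Ico,
    Finset.sum_Ico_add' (fun j => c j s * L (s + j)), zero_add, Finset.Ico_add_one_right_eq_Icc]
  simp only [add_assoc, shiftTail]

/-- The right-hand side of the functional equation `D(s) L(s) = h(s) + ∑_{j ≥ 1} c_j(s) L(s + j)`
solved for `L(s)`, with `K` in place of `L` in the first `m` terms of the series. -/
noncomputable def truncatedSolution (D h : ℂ → ℂ) (c : ℕ → ℂ → ℂ) (L K : ℂ → ℂ) (m : ℕ) (s : ℂ) :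
    ℂ :=
  (D s)⁻¹ * (h s + (∑ j ∈ Finset.Icc 1 m, c j s * K (s + j) + shiftTail c L (m + 1) s))

/-- The functional equation `D(s) L(s) = h(s) + ∑_{j ≥ 1} c_j(s) L(s + j)` on the half-plane
`Re s > σ₀`, together with the regularity and the bounds by which it continues `L` to the plane. -/
structure ShiftEquation (σ₀ : ℝ) (D h : ℂ → ℂ) (c : ℕ → ℂ → ℂ) (L : ℂ → ℂ) : Prop where
  differentiable_left : Differentiable ℂ D
  left_ne_zero : ∀ s : ℂ, σ₀ < s.re → D s ≠ 0
  differentiable_inhom : Differentiable ℂ h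
  differentiable_coeff : ∀ j, Differentiable ℂ (c j)
  coeff_bound : ∀ R : ℝ, ∃ u : ℕ → ℝ, Summable u ∧ ∀ j s, ‖s‖ ≤ R → ‖c j s‖ ≤ u j
  differentiableOn : DifferentiableOn ℂ L {s | σ₀ < s.re}
  bound : ∀ σ > σ₀, ∃ M : ℝ, ∀ s : ℂ, σ ≤ s.re → ‖L s‖ ≤ M
  equation : ∀ s : ℂ, σ₀ < s.re → D s * L s = h s + shiftTail c L 1 s

/-- `K` is a meromorphic continuation to the plane of a function `L` given for `Re s > σ₀`. -/
structure IsMeromorphicContinuation (σ₀ : ℝ) (L K : ℂ → ℂ) : Prop where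
  meromorphicOn : MeromorphicOn K Set.univ
  eq : ∀ s : ℂ, σ₀ < s.re → K s = L s

/-- `z` is a simple zero of `D`, and `D` does not vanish at the points `z - 1, z - 2, …`: what makes
the poles of a function with a shift equation simple along the sequence `z - m`. -/
structure IsLeftmostSimpleZero (D : ℂ → ℂ) (z : ℂ) : Prop where
  eq_zero : D z = 0
  deriv_ne_zero : deriv D z ≠ 0
  sub_natCast_ne_zero : ∀ m : ℕ, m ≠ 0 → D (z - m) ≠ 0

theorem lt_re_add_natCast {σ : ℝ} {s : ℂ} {m j : ℕ} (hs : σ < s.re + m) (hmj : m ≤ j) :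
    σ < (s + j).re := by
  rw [Complex.add_re, Complex.natCast_re]
  exact hs.trans_le (by gcongr)

theorem isOpen_lt_re_add (σ a : ℝ) : IsOpen {s : ℂ | σ < s.re + a} :=
  isOpen_lt continuous_const (Complex.continuous_re.add continuous_const)

/-- The successive continuations of `L` given by its functional equation: the `J`-th one is the
continuation of `L` to `Re s > σ₀ - J`. -/
noncomputable def shiftIterate (D h : ℂ → ℂ) (c : ℕ → ℂ → ℂ) (L : ℂ → ℂ) : ℕ → ℂ → ℂ
  | 0 => L
  | J + 1 => fun s => (D s)⁻¹ * (h s + shiftTail c (shiftIterate D h c L J) 1 s)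

namespace ShiftEquation

variable {σ₀ : ℝ} {D h : ℂ → ℂ} {c : ℕ → ℂ → ℂ} {L K : ℂ → ℂ}

theorem exists_majorant (E : ShiftEquation σ₀ D h c L) {σ : ℝ} (hσ : σ₀ < σ) (R : ℝ) :
    ∃ v : ℕ → ℝ, Summable v ∧
      ∀ (j : ℕ) (s : ℂ), ‖s‖ ≤ R → σ ≤ (s + j).re → ‖c j s * L (s + j)‖ ≤ v j := by
  obtain ⟨u, hu, hcu⟩ := E.coeff_bound R
  obtain ⟨M, hM⟩ := E.bound σ hσ
  refine ⟨fun j => u j * M, hu.mul_right M, fun j s hs hsσ => ?_⟩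
  rw [norm_mul]
  exact mul_le_mul (hcu j s hs) (hM _ hsσ) (norm_nonneg _)
    ((norm_nonneg _).trans (hcu j s hs))

theorem summable_tail (E : ShiftEquation σ₀ D h c L) {m : ℕ} {s : ℂ} (hs : σ₀ < s.re + m) :
    Summable fun j => c (j + m) s * L (s + (j + m : ℕ)) := by
  obtain ⟨v, hv, hle⟩ := E.exists_majorant hs ‖s‖
  exact .of_norm_bounded ((summable_nat_add_iff m).2 hv) fun j =>
    hle (j + m) s le_rfl (by simp)

theorem analyticAt_shiftTail (E : ShiftEquation σ₀ D h c L) {m : ℕ} {z : ℂ}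
    (hz : σ₀ < z.re + m) : AnalyticAt ℂ (shiftTail c L m) z := by
  obtain ⟨σ, hσ, hσz⟩ := exists_between hz
  obtain ⟨v, hv, hle⟩ := E.exists_majorant hσ (‖z‖ + 1)
  set U : Set ℂ := {s | ‖s‖ < ‖z‖ + 1} ∩ {s | σ < s.re + m}
  have hU : IsOpen U := (isOpen_lt continuous_norm continuous_const).inter (isOpen_lt_re_add σ m)
  refine DifferentiableOn.analyticAt (s := U) ?_ (hU.mem_nhds ⟨lt_add_one ‖z‖, hσz⟩)
  refine Complex.differentiableOn_tsum_of_summable_norm ((summable_nat_add_iff m).2 hv)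
    (fun j => ?_) hU fun j s hs => hle _ s hs.1.le (lt_re_add_natCast hs.2 (by omega)).le
  exact (E.differentiable_coeff _).differentiableOn.mul
    (E.differentiableOn.comp (differentiableOn_id.add_const _) fun s hs =>
      lt_re_add_natCast (hσ.trans hs.2) (by omega))

theorem eq_truncatedSolution (E : ShiftEquation σ₀ D h c L) (m : ℕ) {s : ℂ} (hs : σ₀ < s.re) :
    L s = truncatedSolution D h c L L m s := by
  have hsm : σ₀ < s.re + (m + 1 : ℕ) := by linarith [(m + 1).cast_nonneg (α := ℝ)]
  rw [truncatedSolution, ← shiftTail_one_eq_sum_add (E.summable_tail hsm), ← E.equation s hs,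
    inv_mul_cancel_left₀ (E.left_ne_zero s hs)]

theorem meromorphicAt_truncatedSolution (E : ShiftEquation σ₀ D h c L) {m : ℕ} {z : ℂ}
    (hz : σ₀ < z.re + (m + 1 : ℕ)) (hK : ∀ j ∈ Finset.Icc 1 m, MeromorphicAt K (z + j)) :
    MeromorphicAt (truncatedSolution D h c L K m) z := by
  refine (E.differentiable_left.analyticAt z).meromorphicAt.inv.mul
    ((E.differentiable_inhom.analyticAt z).meromorphicAt.add
      (.add (.fun_sum fun j hj => ?_) (E.analyticAt_shiftTail hz).meromorphicAt))
  exact ((E.differentiable_coeff j).analyticAt z).meromorphicAt.mul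
    (meromorphicAt_comp_add_const_iff_meromorphicAt.2 (hK j hj))

theorem shiftIterate_succ_eq (E : ShiftEquation σ₀ D h c L) (J : ℕ) {s : ℂ}
    (hs : σ₀ < s.re + J) : shiftIterate D h c L (J + 1) s = shiftIterate D h c L J s := by
  induction J generalizing s with
  | zero =>
    have hs₀ : σ₀ < s.re := by simpa using hs
    simp only [shiftIterate, ← E.equation s hs₀, inv_mul_cancel_left₀ (E.left_ne_zero s hs₀)]
  | succ J ih =>
    have htail : shiftTail c (shiftIterate D h c L (J + 1)) 1 s =
        shiftTail c (shiftIterate D h c L J) 1 s := by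
      refine tsum_congr fun j => ?_
      rw [ih]
      rw [Complex.add_re, Complex.natCast_re]
      push_cast at hs ⊢
      linarith [j.cast_nonneg (α := ℝ)]
    simp only [shiftIterate] at htail ⊢
    rw [htail]

theorem shiftIterate_eq_of_le (E : ShiftEquation σ₀ D h c L) {J J' : ℕ} (hJ : J ≤ J') {s : ℂ}
    (hs : σ₀ < s.re + J) : shiftIterate D h c L J' s = shiftIterate D h c L J s := by
  induction J', hJ using Nat.le_induction with
  | base => rfl
  | succ J' hJ ih => rw [E.shiftIterate_succ_eq J' (hs.trans_le (by gcongr)), ih]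

theorem shiftIterate_eq (E : ShiftEquation σ₀ D h c L) (J : ℕ) {s : ℂ} (hs : σ₀ < s.re) :
    shiftIterate D h c L J s = L s :=
  E.shiftIterate_eq_of_le J.zero_le (by simpa using hs)

theorem shiftIterate_succ_eq_truncatedSolution (E : ShiftEquation σ₀ D h c L) {J : ℕ} {s : ℂ}
    (hs : σ₀ < s.re + (J + 1 : ℕ)) :
    shiftIterate D h c L (J + 1) s =
      truncatedSolution D h c L (shiftIterate D h c L J) J s := by
  simp only [shiftIterate, truncatedSolution]
  have heq (j : ℕ) : shiftIterate D h c L J (s + (j + (J + 1) : ℕ)) =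
      L (s + (j + (J + 1) : ℕ)) :=
    E.shiftIterate_eq J (lt_re_add_natCast hs (by omega))
  generalize shiftIterate D h c L J = LJ at heq ⊢
  have htail : shiftTail c LJ (J + 1) s = shiftTail c L (J + 1) s :=
    tsum_congr fun j => by rw [heq]
  have hsummable : Summable fun j => c (j + (J + 1)) s * LJ (s + (j + (J + 1) : ℕ)) := by
    simpa only [heq] using E.summable_tail hs
  rw [shiftTail_one_eq_sum_add hsummable, htail]

theorem meromorphicAt_shiftIterate (E : ShiftEquation σ₀ D h c L) {J : ℕ} {z : ℂ}
    (hz : σ₀ < z.re + J) : MeromorphicAt (shiftIterate D h c L J) z := by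
  induction J generalizing z with
  | zero =>
    have hz₀ : {s : ℂ | σ₀ < s.re + (0 : ℕ)} ∈ 𝓝 z := (isOpen_lt_re_add σ₀ _).mem_nhds hz
    exact (E.differentiableOn.analyticAt (by simpa using hz₀)).meromorphicAt
  | succ J ih =>
    have heq : truncatedSolution D h c L (shiftIterate D h c L J) J =ᶠ[𝓝 z]
        shiftIterate D h c L (J + 1) := by
      filter_upwards [(isOpen_lt_re_add σ₀ _).mem_nhds hz] with s hs
      exact (E.shiftIterate_succ_eq_truncatedSolution hs).symm
    refine (E.meromorphicAt_truncatedSolution hz fun j hj => ih (hz.trans_le ?_)).congr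
      (heq.filter_mono nhdsWithin_le_nhds)
    have hj₁ : (1 : ℝ) ≤ j := by exact_mod_cast (Finset.mem_Icc.1 hj).1
    rw [Complex.add_re, Complex.natCast_re, Nat.cast_succ]
    linarith

theorem exists_isMeromorphicContinuation (E : ShiftEquation σ₀ D h c L) :
    ∃ K, IsMeromorphicContinuation σ₀ L K := by
  let depth (s : ℂ) : ℕ := ⌊σ₀ - s.re⌋₊ + 1
  have hdepth (s : ℂ) : σ₀ < s.re + depth s := by
    have := Nat.lt_floor_add_one (σ₀ - s.re)
    push_cast [depth]
    linarith
  refine ⟨fun s => shiftIterate D h c L (depth s) s, fun z _ => ?_, fun s hs =>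
    E.shiftIterate_eq _ hs⟩
  have heq : shiftIterate D h c L (depth z) =ᶠ[𝓝 z] fun s => shiftIterate D h c L (depth s) s := by
    filter_upwards [(isOpen_lt_re_add σ₀ _).mem_nhds (hdepth z)] with s hs
    rcases le_total (depth z) (depth s) with hle | hle
    · exact (E.shiftIterate_eq_of_le hle hs).symm
    · exact E.shiftIterate_eq_of_le hle (hdepth s)
  exact (E.meromorphicAt_shiftIterate (hdepth z)).congr (heq.filter_mono nhdsWithin_le_nhds)

theorem eventuallyEq_truncatedSolution (E : ShiftEquation σ₀ D h c L)
    (hK : IsMeromorphicContinuation σ₀ L K) {m : ℕ} {z : ℂ} (hz : σ₀ < z.re + (m + 1 : ℕ)) :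
    truncatedSolution D h c L K m =ᶠ[𝓝[≠] z] K := by
  set U : Set ℂ := {s | σ₀ < s.re + (m + 1 : ℕ)}
  have hU : Convex ℝ U := by
    simpa only [U, ← sub_lt_iff_lt_add] using convex_halfSpace_re_gt _
  refine eventuallyEq_nhdsNE_of_meromorphicOn (U := U) (z₀ := (σ₀ + 1 : ℝ))
    (fun s hs => E.meromorphicAt_truncatedSolution hs fun j _ => hK.meromorphicOn _ trivial)
    (fun s _ => hK.meromorphicOn s trivial) hU.isPreconnected
    ?_ hz (EventuallyEq.filter_mono ?_ nhdsWithin_le_nhds)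
  · rw [Set.mem_ofPred_eq, Complex.ofReal_re]
    linarith [(m + 1).cast_nonneg (α := ℝ)]
  filter_upwards [(isOpen_lt_re_add σ₀ (0 : ℕ)).mem_nhds (by simp)] with s hs
  have hs₀ : σ₀ < s.re := by simpa using hs
  have hshift (j : ℕ) : K (s + j) = L (s + j) :=
    hK.eq _ (lt_re_add_natCast hs j.zero_le)
  rw [hK.eq s hs₀, E.eq_truncatedSolution m hs₀]
  simp only [truncatedSolution, hshift]

theorem hasSimpleResidue_of_simple_zero (E : ShiftEquation σ₀ D h c L)
    (hK : IsMeromorphicContinuation σ₀ L K) {z : ℂ} (hz : σ₀ < z.re + 1) (hD₀ : D z = 0)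
    (hD₁ : deriv D z ≠ 0) :
    HasSimpleResidue K z ((deriv D z)⁻¹ * (h z + shiftTail c L 1 z)) := by
  have hsol : truncatedSolution D h c L K 0 =
      fun s => (D s)⁻¹ * (h s + shiftTail c L (0 + 1) s) := by
    ext s
    simp [truncatedSolution]
  have hz₁ : σ₀ < z.re + (0 + 1 : ℕ) := by simpa using hz
  have heq := E.eventuallyEq_truncatedSolution hK hz₁
  rw [hsol] at heq
  exact (HasSimpleResidue.inv_mul_of_simple_zero
    (E.differentiable_left.analyticAt z) hD₀ hD₁
    ((E.differentiable_inhom.analyticAt z).fun_add (E.analyticAt_shiftTail hz₁))).congr heq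

theorem hasSimpleResidue_of_left_ne_zero (E : ShiftEquation σ₀ D h c L)
    (hK : IsMeromorphicContinuation σ₀ L K) {m : ℕ} {z : ℂ} (hz : σ₀ < z.re + (m + 1 : ℕ))
    (hD : D z ≠ 0) {r : ℕ → ℂ} (hr : ∀ j ∈ Finset.Icc 1 m, HasSimpleResidue K (z + j) (r j)) :
    HasSimpleResidue K z ((D z)⁻¹ * ∑ j ∈ Finset.Icc 1 m, c j z * r j) := by
  have hsum := HasSimpleResidue.sum fun j hj =>
    ((hr j hj).comp_add_const (j : ℂ)).analyticAt_mul ((E.differentiable_coeff j).analyticAt z)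
  have hrhs := (HasSimpleResidue.of_analyticAt (E.differentiable_inhom.analyticAt z)).add
    (hsum.add (.of_analyticAt (E.analyticAt_shiftTail hz)))
  rw [zero_add, add_zero] at hrhs
  exact (hrhs.analyticAt_mul ((E.differentiable_left.analyticAt z).inv hD)).congr
    (E.eventuallyEq_truncatedSolution hK hz)

theorem hasSimpleResidue_sub_natCast (E : ShiftEquation σ₀ D h c L)
    (hK : IsMeromorphicContinuation σ₀ L K) {z : ℂ} (hz : σ₀ < z.re + 1)
    (hD : IsLeftmostSimpleZero D z) (m : ℕ) :
    HasSimpleResidue K (z - m) (complexResidue K (z - m)) := by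
  suffices ∃ r, HasSimpleResidue K (z - m) r by
    obtain ⟨r, hr⟩ := this
    rwa [hr.complexResidue_eq]
  induction m using Nat.strong_induction_on with
  | _ m ih =>
    rcases eq_or_ne m 0 with rfl | hm
    · simpa using ⟨_, E.hasSimpleResidue_of_simple_zero hK hz hD.eq_zero hD.deriv_ne_zero⟩
    · have hr : ∀ j ∈ Finset.Icc 1 m, ∃ r, HasSimpleResidue K (z - m + j) r := by
        intro j hj
        obtain ⟨hj₁, hjm⟩ := Finset.mem_Icc.1 hj
        simpa [Nat.cast_sub hjm, sub_add] using ih (m - j) (by omega)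
      choose! r hr using hr
      refine ⟨_, E.hasSimpleResidue_of_left_ne_zero hK ?_ (hD.sub_natCast_ne_zero m hm) hr⟩
      rw [Complex.sub_re, Complex.natCast_re, Nat.cast_succ]
      linarith

theorem left_mul_complexResidue (E : ShiftEquation σ₀ D h c L)
    (hK : IsMeromorphicContinuation σ₀ L K) {z : ℂ} (hz : σ₀ < z.re + 1)
    (hD : IsLeftmostSimpleZero D z) {m : ℕ} (hm : m ≠ 0) :
    D (z - m) * complexResidue K (z - m) =
      ∑ j ∈ Finset.Icc 1 m, c j (z - m) * complexResidue K (z - (m - j : ℕ)) := by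
  have hr : ∀ j ∈ Finset.Icc 1 m,
      HasSimpleResidue K (z - m + j) (complexResidue K (z - (m - j : ℕ))) := by
    intro j hj
    have := E.hasSimpleResidue_sub_natCast hK hz hD (m - j)
    simpa [Nat.cast_sub (Finset.mem_Icc.1 hj).2, sub_add] using this
  have hzm : σ₀ < (z - m).re + (m + 1 : ℕ) := by
    rw [Complex.sub_re, Complex.natCast_re, Nat.cast_succ]
    linarith
  have hDm := hD.sub_natCast_ne_zero m hm
  rw [(E.hasSimpleResidue_of_left_ne_zero hK hzm hDm hr).complexResidue_eq,
    mul_inv_cancel_left₀ hDm]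

end ShiftEquation

/-! ### Binomial series -/

theorem ringChoose_eq_prod_div {F : Type*} [Field F] [CharZero F] (x : F) (j : ℕ) :
    Ring.choose x j = (∏ i ∈ Finset.range j, (x - i)) / j.factorial := by
  rw [Ring.choose_eq_smul, ← Polynomial.aeval_eq_smeval, ← Polynomial.eval_map_algebraMap,
    descPochhammer_map, descPochhammer_eval_eq_prod_range, smul_eq_mul, div_eq_inv_mul]

theorem differentiable_ringChoose (j : ℕ) : Differentiable ℂ fun s : ℂ => Ring.choose s j := by
  simp only [ringChoose_eq_prod_div]
  fun_prop

theorem norm_ringChoose_le {s : ℂ} {R : ℝ} (hs : ‖s‖ ≤ R) (j : ℕ) :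
    ‖Ring.choose s j‖ ≤ ‖Ring.choose (-R : ℂ) j‖ := by
  have hR : 0 ≤ R := (norm_nonneg s).trans hs
  simp only [ringChoose_eq_prod_div, norm_div, norm_prod]
  gcongr with i
  calc ‖s - i‖ ≤ ‖s‖ + ‖(i : ℂ)‖ := norm_sub_le _ _
    _ ≤ R + i := by rw [Complex.norm_natCast]; gcongr
    _ = ‖(-R - i : ℂ)‖ := by
      rw [← neg_add', norm_neg]
      exact_mod_cast (Real.norm_of_nonneg (by positivity : 0 ≤ R + i)).symm

theorem hasSum_ringChoose_mul_pow (a : ℂ) {x : ℂ} (hx : ‖x‖ < 1) :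
    HasSum (fun j => Ring.choose a j * x ^ j) ((1 + x) ^ a) := by
  simpa only [zero_add, binomialSeries_apply, List.ofFn_const, List.prod_replicate, smul_eq_mul]
    using Complex.one_add_cpow_hasFPowerSeriesOnBall_zero.hasSum (y := x)
      (by simpa [← ENNReal.ofReal_one, Metric.eball_ofReal] using hx)

theorem summable_norm_ringChoose_mul_pow (a : ℂ) {ρ : ℝ} (hρ₀ : 0 ≤ ρ) (hρ₁ : ρ < 1) :
    Summable fun j => ‖Ring.choose a j‖ * ρ ^ j := by
  have hρ : ‖(ρ : ℂ)‖ = ρ := Complex.norm_of_nonneg hρ₀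
  simpa only [norm_mul, norm_pow, hρ] using
    (hasSum_ringChoose_mul_pow a (hρ.trans_lt hρ₁)).summable.norm

/-! ### Digit-multiplicative Dirichlet series -/

theorem sum_range_mul_eq_sum_block {M : Type*} [AddCommMonoid M] (f : ℕ → M) (b X : ℕ) :
    ∑ n ∈ Finset.range (b * X), f n =
      ∑ n ∈ Finset.range X, ∑ a ∈ Finset.range b, f (b * n + a) := by
  induction X with
  | zero => simp
  | succ X ih => rw [mul_add_one, Finset.sum_range_add, ih, Finset.sum_range_succ]

theorem hasSum_sum_block {M : Type*} [AddCommMonoid M] [TopologicalSpace M] [ContinuousAdd M]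
    [RegularSpace M] {b : ℕ} (hb : b ≠ 0) {f : ℕ → M} {x : M} (hf : HasSum f x) :
    HasSum (fun n => ∑ a ∈ Finset.range b, f (b * n + a)) x := by
  have : NeZero b := ⟨hb⟩
  simp only [Finset.sum_range]
  refine ((Nat.divModEquiv b).symm.hasSum_iff.2 hf).prod_fiberwise fun n => ?_
  simpa [mul_comm b] using hasSum_fintype fun a : Fin b => f (b * n + a)

theorem summable_of_sum_block_le {b : ℕ} (hb : b ≠ 0) {q : ℝ} (hq₀ : 0 ≤ q) (hq₁ : q < 1)
    {t : ℕ → ℝ} (ht : ∀ n, 0 ≤ t n)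
    (h : ∀ n ≠ 0, ∑ a ∈ Finset.range b, t (b * n + a) ≤ q * t n) : Summable t := by
  set S : ℕ → ℝ := fun X => ∑ n ∈ Finset.range X, t n
  have hS : Monotone S := fun X Y hXY =>
    Finset.sum_le_sum_of_subset_of_nonneg (Finset.range_subset_range.2 hXY) fun n _ _ => ht n
  have hS_succ (X : ℕ) : S (X + 1) ≤ q * S (X + 1) + S b :=
    calc S (X + 1) ≤ S (b * (X + 1)) := hS (Nat.le_mul_of_pos_left _ (Nat.pos_of_ne_zero hb))
      _ = ∑ n ∈ Finset.range X, ∑ a ∈ Finset.range b, t (b * (n + 1) + a) + S b := by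
        simp only [S, sum_range_mul_eq_sum_block, Finset.sum_range_succ' _ X, mul_zero, zero_add]
      _ ≤ ∑ n ∈ Finset.range X, q * t (n + 1) + S b := by
        gcongr with n
        exact h _ n.succ_ne_zero
      _ ≤ q * S (X + 1) + S b := by
        rw [← Finset.mul_sum]
        gcongr
        simpa only [S, Finset.sum_range_succ' t X] using le_add_of_nonneg_right (ht 0)
  refine summable_of_sum_range_le (c := S b / (1 - q)) ht fun X => (hS X.le_succ).trans ?_
  rw [le_div_iff₀ (sub_pos.2 hq₁)]
  linarith [hS_succ X]

theorem LSeries_term_add_natCast (f : ℕ → ℂ) (s : ℂ) (j n : ℕ) :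
    LSeries.term f (s + j) n = LSeries.term f s n * ((n : ℂ)⁻¹) ^ j := by
  rcases eq_or_ne n 0 with rfl | hn
  · simp
  · rw [LSeries.term_of_ne_zero hn, LSeries.term_of_ne_zero hn,
      Complex.cpow_add _ _ (Nat.cast_ne_zero.2 hn), Complex.cpow_natCast, inv_pow,
      ← div_eq_mul_inv, div_div]

theorem norm_LSeries_le_of_re_le_re {f : ℕ → ℂ} {s s' : ℂ} (hs : LSeriesSummable f s)
    (h : s.re ≤ s'.re) : ‖LSeries f s'‖ ≤ ∑' n, ‖LSeries.term f s n‖ :=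
  tsum_of_norm_bounded hs.norm.hasSum (LSeries.norm_term_le_of_re_le_re f h)

/-- `f` is multiplicative in the radix-`b` digits with weights `w`: appending the digit `a` to the
radix-`b` representation of `n > 0` multiplies `f n` by `w a`. Nothing is required of the values
of `f` at one-digit numbers. -/
def IsDigitMultiplicative (b : ℕ) (w f : ℕ → ℂ) : Prop :=
  ∀ n ≠ 0, ∀ a < b, f (b * n + a) = w a * f n

/-- The coefficient `(-s choose j) ∑_{a < b} w(a) (a / b) ^ j` of `L(s + j)` in the functional
equation of the Dirichlet series `L` with digit-multiplicative coefficients. -/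
noncomputable def digitCoeff (b : ℕ) (w : ℕ → ℂ) (j : ℕ) (s : ℂ) : ℂ :=
  Ring.choose (-s) j * ∑ a ∈ Finset.range b, w a * ((a : ℂ) / b) ^ j

theorem digitCoeff_zero (b : ℕ) (w : ℕ → ℂ) (s : ℂ) :
    digitCoeff b w 0 s = ∑ a ∈ Finset.range b, w a := by
  simp [digitCoeff]

theorem differentiable_digitCoeff (b : ℕ) (w : ℕ → ℂ) (j : ℕ) :
    Differentiable ℂ (digitCoeff b w j) :=
  ((differentiable_ringChoose j).comp differentiable_neg).mul_const _

theorem exists_digitCoeff_bound (b : ℕ) (w : ℕ → ℂ) (R : ℝ) :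
    ∃ u : ℕ → ℝ, Summable u ∧ ∀ j s, ‖s‖ ≤ R → ‖digitCoeff b w j s‖ ≤ u j := by
  rcases eq_or_ne b 0 with rfl | hb
  · exact ⟨0, summable_zero, fun j s _ => by simp [digitCoeff]⟩
  set ρ : ℝ := 1 - (b : ℝ)⁻¹
  have hb₁ : (1 : ℝ) ≤ b := by exact_mod_cast Nat.one_le_iff_ne_zero.2 hb
  have hρ₀ : 0 ≤ ρ := sub_nonneg.2 (inv_le_one_of_one_le₀ hb₁)
  have hρ₁ : ρ < 1 := sub_lt_self 1 (by positivity)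
  refine ⟨_, (summable_norm_ringChoose_mul_pow (-R) hρ₀ hρ₁).mul_right
    (∑ a ∈ Finset.range b, ‖w a‖), fun j s hs => ?_⟩
  rw [digitCoeff, norm_mul, mul_assoc, Finset.mul_sum]
  refine mul_le_mul (norm_ringChoose_le (by rwa [norm_neg]) j)
    (norm_sum_le_of_le _ fun a ha => ?_) (norm_nonneg _) (norm_nonneg _)
  have haρ : ‖(a : ℂ) / b‖ ≤ ρ := by
    have hab : (a : ℝ) + 1 ≤ b := by exact_mod_cast Finset.mem_range.1 ha
    rw [norm_div, Complex.norm_natCast, Complex.norm_natCast, div_le_iff₀ (by positivity), sub_mul,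
      inv_mul_cancel₀ (by positivity)]
    linarith
  rw [norm_mul, norm_pow, mul_comm]
  gcongr

theorem summable_uncurry_digitCoeff_mul_term (b : ℕ) (w : ℕ → ℂ) {f : ℕ → ℂ} {s : ℂ}
    (hs : LSeriesSummable f s) :
    Summable (Function.uncurry fun n j : ℕ => digitCoeff b w j s * LSeries.term f (s + j) n) := by
  obtain ⟨u, hu, hle⟩ := exists_digitCoeff_bound b w ‖s‖
  have hu₀ (j : ℕ) : 0 ≤ u j := (norm_nonneg _).trans (hle j s le_rfl)
  refine .of_norm_bounded (hs.norm.mul_of_nonneg hu (fun _ => norm_nonneg _) hu₀) fun p => ?_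
  rw [Function.uncurry, norm_mul, mul_comm]
  exact mul_le_mul (LSeries.norm_term_le_of_re_le_re f (by simp) _) (hle _ s le_rfl)
    (norm_nonneg _) (norm_nonneg _)

theorem summable_digitCoeff_mul_LSeries (b : ℕ) (w : ℕ → ℂ) {f : ℕ → ℂ} {s : ℂ}
    (hs : LSeriesSummable f s) : Summable fun j : ℕ => digitCoeff b w j s * LSeries f (s + j) := by
  simpa only [Function.uncurry, Prod.swap, tsum_mul_left, LSeries] using
    (summable_uncurry_digitCoeff_mul_term b w hs).prod_symm.prod

theorem hasSum_tsum_digitCoeff_mul_term (b : ℕ) (w : ℕ → ℂ) {f : ℕ → ℂ} {s : ℂ}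
    (hs : LSeriesSummable f s) :
    HasSum (fun n => ∑' j : ℕ, digitCoeff b w j s * LSeries.term f (s + j) n)
      (∑' j : ℕ, digitCoeff b w j s * LSeries f (s + j)) := by
  have hdouble := summable_uncurry_digitCoeff_mul_term b w hs
  have hswap := hdouble.tsum_comm
  simp only [tsum_mul_left] at hswap
  exact hswap ▸ hdouble.prod.hasSum

namespace IsDigitMultiplicative

variable {b : ℕ} {w f : ℕ → ℂ}

theorem cpow_mul_term (hf : IsDigitMultiplicative b w f) {a n : ℕ} (ha : a < b) (hn : n ≠ 0)
    (s : ℂ) :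
    (b : ℂ) ^ s * LSeries.term f s (b * n + a) =
      w a * (LSeries.term f s n * (1 + (a : ℂ) / b * (n : ℂ)⁻¹) ^ (-s)) := by
  have hb : b ≠ 0 := Nat.ne_zero_of_lt ha
  have hbs : (b : ℂ) ^ s ≠ 0 := by simp [Complex.cpow_eq_zero_iff, hb]
  have hfactor : ((b * n + a : ℕ) : ℂ) ^ s =
      (b : ℂ) ^ s * (n : ℂ) ^ s * (1 + (a : ℂ) / b * (n : ℂ)⁻¹) ^ s := by
    have hreal : ((b * n + a : ℕ) : ℂ) =
        ((b * n : ℝ) : ℂ) * ((1 + (a : ℝ) / b * (n : ℝ)⁻¹ : ℝ) : ℂ) := by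
      push_cast
      field_simp
    rw [hreal, Complex.mul_cpow_ofReal_nonneg (by positivity) (by positivity)]
    push_cast
    rw [Complex.natCast_mul_natCast_cpow]
  rw [LSeries.term_of_ne_zero (by positivity), LSeries.term_of_ne_zero hn, hf n hn a ha, hfactor,
    Complex.cpow_neg]
  field_simp

theorem rpow_mul_norm_term_le (hf : IsDigitMultiplicative b w f) {a n : ℕ} (ha : a < b)
    (hn : n ≠ 0) {s : ℂ} (hs : 0 ≤ s.re) :
    (b : ℝ) ^ s.re * ‖LSeries.term f s (b * n + a)‖ ≤ ‖w a‖ * ‖LSeries.term f s n‖ := by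
  have hone : ‖(1 + (a : ℂ) / b * (n : ℂ)⁻¹) ^ (-s)‖ ≤ 1 := by
    have hreal : 1 + (a : ℂ) / b * (n : ℂ)⁻¹ = ((1 + (a : ℝ) / b * (n : ℝ)⁻¹ : ℝ) : ℂ) := by
      push_cast
      rfl
    rw [hreal, Complex.norm_cpow_eq_rpow_re_of_pos (by positivity), Complex.neg_re]
    exact Real.rpow_le_one_of_one_le_of_nonpos (le_add_of_nonneg_right (by positivity))
      (neg_nonpos.2 hs)
  rw [← Complex.norm_natCast_cpow_of_pos (Nat.zero_lt_of_lt ha), ← norm_mul,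
    hf.cpow_mul_term ha hn, norm_mul, norm_mul]
  gcongr
  exact mul_le_of_le_one_right (norm_nonneg _) hone

theorem summable_LSeries (hf : IsDigitMultiplicative b w f) (hb : b ≠ 0) {s : ℂ} (hs : 0 ≤ s.re)
    (hw : ∑ a ∈ Finset.range b, ‖w a‖ < (b : ℝ) ^ s.re) : LSeriesSummable f s := by
  have hbs : 0 < (b : ℝ) ^ s.re := by positivity
  refine .of_norm (summable_of_sum_block_le hb (q := (∑ a ∈ Finset.range b, ‖w a‖) / b ^ s.re)
    (by positivity) ((div_lt_one hbs).2 hw) (fun _ => norm_nonneg _) fun n hn => ?_)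
  rw [div_mul_eq_mul_div, le_div_iff₀' hbs, Finset.mul_sum, Finset.sum_mul]
  exact Finset.sum_le_sum fun a ha => hf.rpow_mul_norm_term_le (Finset.mem_range.1 ha) hn hs

theorem hasSum_digitCoeff_mul_term (hf : IsDigitMultiplicative b w f) {n : ℕ} (hn : n ≠ 0)
    (s : ℂ) :
    HasSum (fun j => digitCoeff b w j s * LSeries.term f (s + j) n)
      ((b : ℂ) ^ s * ∑ a ∈ Finset.range b, LSeries.term f s (b * n + a)) := by
  have hdigit : ∀ a ∈ Finset.range b,
      HasSum (fun j => w a * (LSeries.term f s n *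
          (Ring.choose (-s) j * ((a : ℂ) / b * (n : ℂ)⁻¹) ^ j)))
        ((b : ℂ) ^ s * LSeries.term f s (b * n + a)) := by
    intro a ha
    have hab := Finset.mem_range.1 ha
    rw [hf.cpow_mul_term hab hn]
    refine ((hasSum_ringChoose_mul_pow (-s) ?_).mul_left _).mul_left _
    rw [norm_mul, norm_div, norm_inv, Complex.norm_natCast, Complex.norm_natCast,
      Complex.norm_natCast]
    refine mul_lt_one_of_nonneg_of_lt_one_left (by positivity) ?_ ?_
    · exact (div_lt_one (by exact_mod_cast Nat.zero_lt_of_lt hab)).2 (by exact_mod_cast hab)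
    · exact inv_le_one_of_one_le₀ (by exact_mod_cast Nat.one_le_iff_ne_zero.2 hn)
  rw [Finset.mul_sum]
  refine (hasSum_sum hdigit).congr_fun fun j => ?_
  rw [LSeries_term_add_natCast, digitCoeff, Finset.mul_sum, Finset.sum_mul]
  refine Finset.sum_congr rfl fun a _ => ?_
  rw [mul_pow]
  ring

theorem cpow_sub_mul_LSeries (hf : IsDigitMultiplicative b w f) (hb : b ≠ 0) {s : ℂ}
    (hs : LSeriesSummable f s) :
    ((b : ℂ) ^ s - ∑ a ∈ Finset.range b, w a) * LSeries f s =
      (b : ℂ) ^ s * ∑ a ∈ Finset.range b, LSeries.term f s a +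
        shiftTail (digitCoeff b w) (LSeries f) 1 s := by
  set H := (b : ℂ) ^ s * ∑ a ∈ Finset.range b, LSeries.term f s a
  have hblock (n : ℕ) : (b : ℂ) ^ s * ∑ a ∈ Finset.range b, LSeries.term f s (b * n + a) =
      (if n = 0 then H else 0) + ∑' j : ℕ, digitCoeff b w j s * LSeries.term f (s + j) n := by
    rcases eq_or_ne n 0 with rfl | hn
    · simp [H]
    · rw [if_neg hn, zero_add, (hf.hasSum_digitCoeff_mul_term hn s).tsum_eq]
  have hsum : (b : ℂ) ^ s * LSeries f s =
      H + ∑' j : ℕ, digitCoeff b w j s * LSeries f (s + j) := by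
    have hblocks := (hasSum_sum_block hb hs.hasSum).mul_left ((b : ℂ) ^ s)
    simp only [hblock] at hblocks
    exact hblocks.unique ((hasSum_ite_eq 0 H).add (hasSum_tsum_digitCoeff_mul_term b w hs))
  rw [sub_mul, hsum, (summable_digitCoeff_mul_LSeries b w hs).tsum_eq_zero_add, digitCoeff_zero,
    Nat.cast_zero, add_zero, add_left_comm, add_sub_cancel_left, shiftTail]

theorem shiftEquation (hf : IsDigitMultiplicative b w f) (hb : 1 < b) {σ₀ : ℝ} (hσ₀ : 0 ≤ σ₀)
    (hw : ∑ a ∈ Finset.range b, ‖w a‖ ≤ (b : ℝ) ^ σ₀) :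
    ShiftEquation σ₀ (fun s => (b : ℂ) ^ s - ∑ a ∈ Finset.range b, w a)
      (fun s => (b : ℂ) ^ s * ∑ a ∈ Finset.range b, LSeries.term f s a) (digitCoeff b w)
      (LSeries f) := by
  have hb₀ : b ≠ 0 := Nat.ne_zero_of_lt hb
  have hlt {σ : ℝ} (hσ : σ₀ < σ) : ∑ a ∈ Finset.range b, ‖w a‖ < (b : ℝ) ^ σ :=
    hw.trans_lt (Real.rpow_lt_rpow_of_exponent_lt (by exact_mod_cast hb) hσ)
  have hsummable {s : ℂ} (hs : σ₀ < s.re) : LSeriesSummable f s :=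
    hf.summable_LSeries hb₀ (hσ₀.trans hs.le) (hlt hs)
  have hcpow : Differentiable ℂ fun s : ℂ => (b : ℂ) ^ s :=
    differentiable_id.const_cpow (.inl (Nat.cast_ne_zero.2 hb₀))
  refine
    { differentiable_left := hcpow.sub_const _
      left_ne_zero := fun s hs => ?_
      differentiable_inhom := hcpow.mul (.fun_sum fun a _ s =>
        (LSeries.hasDerivAt_term f a s).differentiableAt)
      differentiable_coeff := differentiable_digitCoeff b w
      coeff_bound := exists_digitCoeff_bound b w
      differentiableOn := (LSeries_differentiableOn f).mono fun s hs => ?_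
      bound := fun σ hσ => ⟨_, fun s hs => norm_LSeries_le_of_re_le_re (s := σ) (hsummable hσ) hs⟩
      equation := fun s hs => hf.cpow_sub_mul_LSeries hb₀ (hsummable hs) }
  · refine sub_ne_zero.2 fun h => ((norm_sum_le _ _).trans_lt (hlt hs)).ne ?_
    rw [← h, Complex.norm_natCast_cpow_of_pos (Nat.pos_of_ne_zero hb₀)]
  · have : LSeries.abscissaOfAbsConv f ≤ σ₀ :=
      LSeries.abscissaOfAbsConv_le_of_forall_lt_LSeriesSummable fun σ hσ =>
        hsummable (s := σ) hσ
    exact this.trans_lt (by exact_mod_cast hs)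

end IsDigitMultiplicative

/-! ### Integers with restricted digits -/

theorem sum_range_indicator_one_mul {A : Finset ℕ} {b : ℕ} {R : Type*} [NonAssocSemiring R]
    (hAb : ∀ a ∈ A, a < b) (g : ℕ → R) :
    ∑ a ∈ Finset.range b, (A : Set ℕ).indicator 1 a * g a = ∑ a ∈ A, g a := by
  rw [← Finset.sum_indicator_subset g fun a ha => Finset.mem_range.2 (hAb a ha)]
  exact Finset.sum_congr rfl fun a _ => by simp [Set.indicator_apply]

section RestrictedDirichlet

variable {b : ℕ} {A : Finset ℕ} {K : ℂ → ℂ}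

theorem admissible_mul_add_iff (hb : 1 < b) {a n : ℕ} (ha : a < b) (hn : n ≠ 0) :
    Admissible b A (b * n + a) ↔ a ∈ A ∧ Admissible b A n := by
  rw [Admissible, add_comm, Nat.digits_add b hb a n ha (.inr hn), List.forall_mem_cons, Admissible]

theorem isDigitMultiplicative_admissibleCoeff (hb : 1 < b) :
    IsDigitMultiplicative b ((A : Set ℕ).indicator 1) (admissibleCoeff b A) := by
  classical
  intro n hn a ha
  simp only [admissibleCoeff, Set.indicator_apply, Set.mem_ofPred_eq, Finset.mem_coe,
    admissible_mul_add_iff hb ha hn, ite_and, Pi.one_apply, ite_mul, one_mul, zero_mul]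

theorem abscissa_nonneg (hb : 1 < b) (hA : A.Nonempty) : 0 ≤ abscissa b A :=
  Real.logb_nonneg (by exact_mod_cast hb) (by exact_mod_cast hA.card_pos)

theorem rpow_abscissa (hb : 1 < b) (hA : A.Nonempty) : (b : ℝ) ^ abscissa b A = A.card :=
  Real.rpow_logb (by positivity) (by exact_mod_cast hb.ne') (by exact_mod_cast hA.card_pos)

theorem sum_norm_indicator_one (hAb : ∀ a ∈ A, a < b) :
    ∑ a ∈ Finset.range b, ‖(A : Set ℕ).indicator (1 : ℕ → ℂ) a‖ = A.card := by
  simpa [Set.indicator_apply, apply_ite norm] using sum_range_indicator_one_mul hAb (1 : ℕ → ℝ)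

theorem shiftEquation_admissibleCoeff (hb : 1 < b) (hAb : ∀ a ∈ A, a < b) (hA : A.Nonempty) :
    ShiftEquation (abscissa b A) (fun s => (b : ℂ) ^ s - A.card)
      (fun s => (b : ℂ) ^ s * ∑ a ∈ Finset.range b, LSeries.term (admissibleCoeff b A) s a)
      (fun j s => Ring.choose (-s) j * (digitPowerSum A j / (b : ℂ) ^ j))
      (LSeries (admissibleCoeff b A)) := by
  have hcoeff : digitCoeff b ((A : Set ℕ).indicator 1) =
      fun j s => Ring.choose (-s) j * (digitPowerSum A j / (b : ℂ) ^ j) := by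
    ext j s
    rw [digitCoeff, sum_range_indicator_one_mul hAb, digitPowerSum, Finset.sum_div]
    simp only [div_pow]
  have hcard : ∑ a ∈ Finset.range b, (A : Set ℕ).indicator (1 : ℕ → ℂ) a = A.card := by
    simpa using sum_range_indicator_one_mul hAb (1 : ℕ → ℂ)
  have hE := (isDigitMultiplicative_admissibleCoeff (A := A) hb).shiftEquation hb
    (abscissa_nonneg hb hA) (by rw [sum_norm_indicator_one hAb, rpow_abscissa hb hA])
  rwa [hcoeff, hcard] at hE

theorem summable_LSeries_admissibleCoeff (hb : 1 < b) (hAb : ∀ a ∈ A, a < b) (hA : A.Nonempty)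
    {s : ℂ} (hs : abscissa b A < s.re) : LSeriesSummable (admissibleCoeff b A) s := by
  refine (isDigitMultiplicative_admissibleCoeff hb).summable_LSeries (Nat.ne_zero_of_lt hb)
    ((abscissa_nonneg hb hA).trans hs.le) ?_
  rw [sum_norm_indicator_one hAb, ← rpow_abscissa hb hA]
  exact Real.rpow_lt_rpow_of_exponent_lt (by exact_mod_cast hb) hs

theorem isRestrictedDirichlet_iff (hb : 1 < b) (hAb : ∀ a ∈ A, a < b) (hA : A.Nonempty) :
    IsRestrictedDirichlet b A K ↔
      IsMeromorphicContinuation (abscissa b A) (LSeries (admissibleCoeff b A)) K where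
  mp hK := ⟨hK.meromorphic, fun s hs => (hK.hasSum s hs).LSeries_eq.symm⟩
  mpr hK := ⟨hK.meromorphicOn, fun s hs => by
    rw [hK.eq s hs]
    exact (summable_LSeries_admissibleCoeff hb hAb hA hs).LSeriesHasSum⟩

theorem latticePoint_eq_zero_sub (b : ℕ) (A : Finset ℕ) (m : ℕ) (k : ℤ) :
    latticePoint b A m k = latticePoint b A 0 k - m := by
  rw [latticePoint, latticePoint, Nat.cast_zero]
  ring

theorem latticePoint_zero_re (b : ℕ) (A : Finset ℕ) (k : ℤ) :
    (latticePoint b A 0 k).re = abscissa b A := by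
  have him : (k * (2 * Real.pi * Complex.I / Real.log b) : ℂ) =
      ((k * (2 * Real.pi / Real.log b) : ℝ) : ℂ) * Complex.I := by
    push_cast
    ring
  rw [latticePoint, him, Complex.add_re, Complex.re_ofReal_mul, Complex.I_re, mul_zero, add_zero,
    Nat.cast_zero, sub_zero, Complex.ofReal_re]

theorem natCast_cpow_latticePoint (hb : 1 < b) (hA : A.Nonempty) (m : ℕ) (k : ℤ) :
    (b : ℂ) ^ latticePoint b A m k = A.card / (b : ℂ) ^ m := by
  have hb₀ : (b : ℂ) ≠ 0 := Nat.cast_ne_zero.2 (Nat.ne_zero_of_lt hb)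
  have hlog : (Real.log b : ℂ) ≠ 0 := by
    exact_mod_cast (Real.log_pos (by exact_mod_cast hb)).ne'
  have habscissa : (b : ℂ) ^ (abscissa b A : ℂ) = A.card := by
    rw [← Complex.ofReal_natCast, ← Complex.ofReal_cpow (by positivity), rpow_abscissa hb hA,
      Complex.ofReal_natCast]
  have hperiod : (b : ℂ) ^ (k * (2 * Real.pi * Complex.I / Real.log b)) = 1 := by
    rw [Complex.cpow_def_of_ne_zero hb₀, ← Complex.natCast_log, mul_left_comm,
      mul_div_cancel₀ _ hlog, Complex.exp_int_mul_two_pi_mul_I]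
  rw [latticePoint, Complex.cpow_add _ _ hb₀, Complex.cpow_sub _ _ hb₀, habscissa, hperiod,
    Complex.cpow_natCast, mul_one]

theorem natCast_cpow_latticePoint_sub_card (hb : 1 < b) (hA : A.Nonempty) (m : ℕ) (k : ℤ) :
    (b : ℂ) ^ latticePoint b A m k - A.card = -A.card * (1 - 1 / (b : ℂ) ^ m) := by
  rw [natCast_cpow_latticePoint hb hA]
  ring

theorem natCast_cpow_latticePoint_sub_card_ne_zero (hb : 1 < b) (hA : A.Nonempty) {m : ℕ}
    (hm : m ≠ 0) (k : ℤ) : (b : ℂ) ^ latticePoint b A m k - A.card ≠ 0 := by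
  rw [natCast_cpow_latticePoint_sub_card hb hA]
  refine mul_ne_zero (neg_ne_zero.2 (by exact_mod_cast hA.card_ne_zero)) (sub_ne_zero.2 fun h => ?_)
  have hpow : (b : ℂ) ^ m = 1 := by simpa using h.symm
  exact (Nat.one_lt_pow hm hb).ne' (by exact_mod_cast hpow)

theorem deriv_natCast_cpow_sub_ne_zero (hb : 1 < b) (c s : ℂ) :
    deriv (fun s => (b : ℂ) ^ s - c) s ≠ 0 := by
  have hb₀ : (b : ℂ) ≠ 0 := Nat.cast_ne_zero.2 (Nat.ne_zero_of_lt hb)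
  have hlog : Complex.log b ≠ 0 := by
    rw [← Complex.natCast_log]
    exact_mod_cast (Real.log_pos (by exact_mod_cast hb)).ne'
  have hderiv : HasDerivAt (fun s => (b : ℂ) ^ s - c) ((b : ℂ) ^ s * Complex.log b) s := by
    simpa only [mul_one] using ((hasDerivAt_id' s).const_cpow (.inl hb₀)).sub_const c
  rw [hderiv.deriv]
  exact mul_ne_zero (Complex.cpow_ne_zero_iff.2 (.inl hb₀)) hlog

theorem ringChoose_neg_latticePoint (b : ℕ) (A : Finset ℕ) (m : ℕ) (k : ℤ) (j : ℕ) :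
    Ring.choose (-latticePoint b A m k) j =
      (∏ i ∈ Finset.range j, ((m : ℂ) - i - latticePoint b A 0 k)) / j.factorial := by
  rw [ringChoose_eq_prod_div]
  congr 1
  refine Finset.prod_congr rfl fun i _ => ?_
  rw [latticePoint_eq_zero_sub]
  ring

theorem isLeftmostSimpleZero_latticePoint (hb : 1 < b) (hA : A.Nonempty) (k : ℤ) :
    IsLeftmostSimpleZero (fun s => (b : ℂ) ^ s - A.card) (latticePoint b A 0 k) where
  eq_zero := by simp [natCast_cpow_latticePoint_sub_card hb hA]
  deriv_ne_zero := deriv_natCast_cpow_sub_ne_zero hb _ _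
  sub_natCast_ne_zero m hm := by
    rw [← latticePoint_eq_zero_sub]
    exact natCast_cpow_latticePoint_sub_card_ne_zero hb hA hm k

theorem hasSimpleResidue_latticePoint (hb : 1 < b) (hAb : ∀ a ∈ A, a < b) (hA : A.Nonempty)
    (hK : IsRestrictedDirichlet b A K) (m : ℕ) (k : ℤ) :
    HasSimpleResidue K (latticePoint b A m k) (complexResidue K (latticePoint b A m k)) := by
  rw [latticePoint_eq_zero_sub]
  exact (shiftEquation_admissibleCoeff hb hAb hA).hasSimpleResidue_sub_natCast
    ((isRestrictedDirichlet_iff hb hAb hA).1 hK) (by simp [latticePoint_zero_re])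
    (isLeftmostSimpleZero_latticePoint hb hA k) m

theorem natCast_cpow_latticePoint_sub_card_mul_complexResidue (hb : 1 < b)
    (hAb : ∀ a ∈ A, a < b) (hA : A.Nonempty) (hK : IsRestrictedDirichlet b A K) {m : ℕ}
    (hm : m ≠ 0) (k : ℤ) :
    ((b : ℂ) ^ latticePoint b A m k - A.card) * complexResidue K (latticePoint b A m k) =
      ∑ j ∈ Finset.Icc 1 m, Ring.choose (-latticePoint b A m k) j *
        (digitPowerSum A j / (b : ℂ) ^ j) * complexResidue K (latticePoint b A (m - j) k) := by
  simpa only [← latticePoint_eq_zero_sub] using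
    (shiftEquation_admissibleCoeff hb hAb hA).left_mul_complexResidue
      ((isRestrictedDirichlet_iff hb hAb hA).1 hK) (by simp [latticePoint_zero_re])
      (isLeftmostSimpleZero_latticePoint hb hA k) hm

theorem one_sub_mul_complexResidue_latticePoint (hb : 1 < b) (hAb : ∀ a ∈ A, a < b)
    (hA : A.Nonempty) (hK : IsRestrictedDirichlet b A K) {m : ℕ} (hm : m ≠ 0) (k : ℤ) :
    (1 - 1 / (b : ℂ) ^ m) * complexResidue K (latticePoint b A m k) =
      -(1 / (A.card : ℂ)) * ∑ j ∈ Finset.Icc 1 m,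
        (∏ i ∈ Finset.range j, ((m : ℂ) - i - latticePoint b A 0 k)) / j.factorial *
          (digitPowerSum A j / (b : ℂ) ^ j) * complexResidue K (latticePoint b A (m - j) k) := by
  have hcard : (A.card : ℂ) ≠ 0 := by exact_mod_cast hA.card_ne_zero
  have h := natCast_cpow_latticePoint_sub_card_mul_complexResidue hb hAb hA hK hm k
  simp only [natCast_cpow_latticePoint_sub_card hb hA, ringChoose_neg_latticePoint] at h
  rw [← h]
  field_simp

theorem complexResidue_latticePoint_eq_zero (hb : 1 < b) (hAb : ∀ a ∈ A, a < b)
    (hA : A.Nonempty) (hK : IsRestrictedDirichlet b A K) {k : ℤ}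
    (h₀ : complexResidue K (latticePoint b A 0 k) = 0) (m : ℕ) :
    complexResidue K (latticePoint b A m k) = 0 := by
  induction m using Nat.strong_induction_on with
  | _ m ih =>
    rcases eq_or_ne m 0 with rfl | hm
    · exact h₀
    · refine (mul_eq_zero.1 ?_).resolve_left
        (natCast_cpow_latticePoint_sub_card_ne_zero hb hA hm k)
      rw [natCast_cpow_latticePoint_sub_card_mul_complexResidue hb hAb hA hK hm]
      refine Finset.sum_eq_zero fun j hj => ?_
      have hj₁ := (Finset.mem_Icc.1 hj).1
      rw [ih (m - j) (by omega), mul_zero]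

end RestrictedDirichlet

theorem mainTheorem7 (b : ℕ) (hb : 1 < b) (A : Finset ℕ) (hAb : ∀ a ∈ A, a < b)
    (hA : ∃ a ∈ A, a ≠ 0) :
    (∃ K : ℂ → ℂ, IsRestrictedDirichlet b A K) ∧
    ∀ K : ℂ → ℂ, IsRestrictedDirichlet b A K →
      (∀ (m : ℕ) (k : ℤ), 1 ≤ m →
        (1 - 1 / (b : ℂ) ^ m) * complexResidue K (latticePoint b A m k) =
          -(1 / (A.card : ℂ)) * ∑ j ∈ Finset.Icc 1 m,
            (∏ i ∈ Finset.range j, ((m : ℂ) - (i : ℂ) - latticePoint b A 0 k)) /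
                (j.factorial : ℂ) *
              (digitPowerSum A j / (b : ℂ) ^ j) *
              complexResidue K (latticePoint b A (m - j) k)) ∧
      (∀ k : ℤ, complexResidue K (latticePoint b A 0 k) = 0 ↔
        ¬ IsPoleOf K (latticePoint b A 0 k)) ∧
      (∀ k : ℤ, complexResidue K (latticePoint b A 0 k) = 0 →
        ∀ m : ℕ, 1 ≤ m → ¬ IsPoleOf K (latticePoint b A m k)) := by
  have hA' : A.Nonempty := hA.imp fun _ h => h.1
  obtain ⟨K₀, hK₀⟩ := (shiftEquation_admissibleCoeff hb hAb hA').exists_isMeromorphicContinuation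
  refine ⟨⟨K₀, (isRestrictedDirichlet_iff hb hAb hA').2 hK₀⟩, fun K hK => ?_⟩
  have not_isPoleOf_iff (m : ℕ) (k : ℤ) :
      ¬ IsPoleOf K (latticePoint b A m k) ↔ complexResidue K (latticePoint b A m k) = 0 :=
    (hasSimpleResidue_latticePoint hb hAb hA' hK m k).isPoleOf_iff.not.trans not_not
  refine ⟨fun m k hm => ?_, fun k => (not_isPoleOf_iff 0 k).symm, fun k h₀ m _ => ?_⟩
  · exact one_sub_mul_complexResidue_latticePoint hb hAb hA' hK (Nat.one_le_iff_ne_zero.1 hm) k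
  · exact (not_isPoleOf_iff m k).2 (complexResidue_latticePoint_eq_zero hb hAb hA' hK h₀ m)
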